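/- **Setting.** Let $(\Omega,\mathcal F)$ be a measurable space and $\mathscr H$ a linear space of $\mathcal F$-measurable real functions on $\Omega$ such that $\varphi(X_1,\dots,X_n)\in\mathscr H$ whenever $X_1,\dots,X_n\in\mathscr H$ and $\varphi:\mathbb R^n\to\mathbb R$ satisfies $|\varphi(x)-\varphi(y)|\le C(1+|x|^m+|y|^m)|x-y|$ for some $C>0$, $m\in\mathbb N$. A sub-linear expectation is a map $\mathbb E:\mathscr H\to[-\infty,\infty]$ that is monotone, satisfies $\mathbb E[c]=c$ for constants $c\in\mathbb R$, $\mathbb E[\lambda X]=\lambda\mathbb E[X]$ for $\lambda\ge0$ (with $0\cdot(\pm\infty)=0$), and $\mathbb E[X+Y]\le\mathbb E[X]+\mathbb E[Y]$ whenever the right side is not of the form $\infty-\infty$; then $(\Omega,\mathscr H,\mathbb E)$ is called a sub-linear expectation space. For an arbitrary $X:\Omega\to\mathbb R$ put $\mathbb E[X]=\inf\{\mathbb E[Y]: Y\in\mathscr H,\ X\le Y\}$ (which agrees with $\mathbb E$ on $\mathscr H$), and $\mathbb V(A)=\mathbb E[I_A]\in[0,1]$. The capacity $\mathbb V$ is countably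 sub-additive if $\mathbb V(\bigcup_n A_n)\le\sum_n\mathbb V(A_n)$ for all $A_n\in\mathcal F$. A measurable $S:\Omega\to\mathbb R$ is tight if $\mathbb V(|S|>x)\to0$ as $x\to\infty$. Random variables $X_1,X_2,\dots\in\mathscr H$ are independent if for every $i\ge1$ and every bounded Lipschitz $\varphi:\mathbb R^i\times\mathbb R\to\mathbb R$, $$\mathbb E[\varphi(X_1,\dots,X_i,X_{i+1})]=\mathbb E\big[\,\mathbb E[\varphi(x,X_{i+1})]\big|_{x=(X_1,\dots,X_i)}\big].$$ **Theorem.** Let $X_1,X_2,\dots\in\mathscr H$ be independent random variables in a sub-linear expectation space $(\Omega,\mathscr H,\mathbb E)$ with associated capacity $\mathbb V$, and let $S_n=\sum_{k=1}^nX_k$. (i) If $S:\Omega\to\mathbb R$ is measurable and tight, and $\mathbb V(|S_n-S|\ge\epsilon)\to0$ as $n\to\infty$ for all $\epsilon>0$, then $\mathbb E[\phi(S_n)]\to\mathbb E[\phi(S)]$ for every bounded continuous $\phi:\mathbb R\to\mathbb R$. (ii) Suppose there are a sub-linear expectation space $(\widetilde\Omega,\widetilde{\mathscr H},\widetilde{\mathbb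 E})$ and a tight measurable function $\widetilde S:\widetilde\Omega\to\mathbb R$ such that $\mathbb E[\phi(S_n)]\to\widetilde{\mathbb E}[\phi(\widetilde S)]$ for every bounded continuous $\phi:\mathbb R\to\mathbb R$. Then $\mathbb V(|S_n-S_m|\ge\epsilon)\to0$ as $n,m\to\infty$ for all $\epsilon>0$. If, furthermore, $\mathbb V$ is countably sub-additive, then there is a tight measurable function $S:\Omega\to\mathbb R$ such that $\mathbb V(|S_n-S|\ge\epsilon)\to0$ as $n\to\infty$ for all $\epsilon>0$ and $$\mathbb V\big(\{\omega:\lim_{n\to\infty}S_n(\omega)\ne S(\omega)\}\big)=0,$$ where the event includes the points $\omega$ at which $S_n(\omega)$ has no limit. -/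

import Mathlib

open Filter Topology
open scoped ENNReal NNReal

universe u v

/-- The class `C_{l,Lip}(ℝⁿ)` of locally Lipschitz functions of polynomial growth
(all norms on `ℝⁿ` give the same class). -/
def IsLocLip {n : ℕ} (φ : (Fin n → ℝ) → ℝ) : Prop :=
  ∃ C : ℝ, 0 < C ∧ ∃ m : ℕ, ∀ x y : Fin n → ℝ,
    |φ x - φ y| ≤ C * (1 + ‖x‖ ^ m + ‖y‖ ^ m) * ‖x - y‖

/-- A sub-linear expectation space `(Ω, ℋ, 𝔼)` over the measurable space `Ω`. -/
structure SublinearSpace (Ω : Type u) [MeasurableSpace Ω] where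
  /-- the linear space of random variables -/
  H : Submodule ℝ (Ω → ℝ)
  measurable_of_mem : ∀ X ∈ H, Measurable X
  comp_mem : ∀ {n : ℕ} (X : Fin n → Ω → ℝ), (∀ i, X i ∈ H) →
    ∀ φ : (Fin n → ℝ) → ℝ, IsLocLip φ → (fun ω => φ (fun i => X i ω)) ∈ H
  /-- the sub-linear expectation -/
  E : H → EReal
  mono : ∀ X Y : H, (∀ ω, (Y : Ω → ℝ) ω ≤ (X : Ω → ℝ) ω) → E Y ≤ E X
  const : ∀ (c : ℝ) (X : H), (∀ ω, (X : Ω → ℝ) ω = c) → E X = (c : EReal)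
  subadd : ∀ X Y : H, ¬ (E X = ⊤ ∧ E Y = ⊥) → ¬ (E X = ⊥ ∧ E Y = ⊤) →
    E (X + Y) ≤ E X + E Y
  pos_homog : ∀ (r : ℝ) (X : H), 0 ≤ r → E (r • X) = (r : EReal) * E X

namespace SublinearSpace

variable {Ω : Type u} [MeasurableSpace Ω] (P : SublinearSpace Ω)

/-- The extension `𝔼[X] = inf {𝔼[Y] : X ≤ Y, Y ∈ ℋ}` of the sub-linear expectation to all real
functions `X` on `Ω`; it agrees with `𝔼` on `ℋ`, see `expect_coe`. -/
noncomputable def expect (X : Ω → ℝ) : EReal :=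
  ⨅ Y : P.H, ⨅ _ : ∀ ω, X ω ≤ (Y : Ω → ℝ) ω, P.E Y

theorem expect_coe (X : P.H) : P.expect (X : Ω → ℝ) = P.E X :=
  le_antisymm (iInf₂_le X fun _ => le_rfl) (le_iInf₂ fun Y h => P.mono Y X h)

/-- The capacity `𝕍(A) = inf {𝔼[ξ] : I_A ≤ ξ, ξ ∈ ℋ}`; it takes values in `[0, 1]`, so nothing is
lost in passing from extended reals to `ℝ≥0∞`, see `coe_capacity` and `capacity_le_one`. -/
noncomputable def capacity (A : Set Ω) : ℝ≥0∞ :=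
  (P.expect (A.indicator fun _ => 1)).toENNReal

theorem const_mem (c : ℝ) : (fun _ : Ω => c) ∈ P.H :=
  P.comp_mem (n := 0) (fun _ _ => 0) (fun i => i.elim0) (fun _ => c)
    ⟨1, one_pos, 0, fun x y => by simp; positivity⟩

theorem coe_capacity (A : Set Ω) :
    (P.capacity A : EReal) = P.expect (A.indicator fun _ => 1) := by
  refine EReal.coe_toENNReal (le_iInf₂ fun Y h => ?_)
  rw [← EReal.coe_zero, ← P.const 0 ⟨_, P.const_mem 0⟩ fun _ => rfl]
  exact P.mono _ _ fun ω => (Set.indicator_nonneg (fun _ _ => zero_le_one) ω).trans (h ω)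

theorem capacity_le_one (A : Set Ω) : P.capacity A ≤ 1 := by
  rw [← EReal.coe_ennreal_le_coe_ennreal_iff, coe_capacity, EReal.coe_ennreal_one,
    ← EReal.coe_one, ← P.const 1 ⟨_, P.const_mem 1⟩ fun _ => rfl]
  exact iInf₂_le _ fun ω => Set.indicator_le_self' (fun _ _ => zero_le_one) ω

/-- Countable sub-additivity of the capacity on the σ-algebra. -/
def CountablySubadditive : Prop :=
  ∀ A : ℕ → Set Ω, (∀ n, MeasurableSet (A n)) →
    P.capacity (⋃ n, A n) ≤ ∑' n, P.capacity (A n)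

/-- The random vector `Y` is independent to the random vector `X`:
`𝔼[φ(X, Y)] = 𝔼[𝔼[φ(x, Y)]|_{x = X}]` for all bounded Lipschitz `φ`.
The inner expectation is finite because `φ` is bounded. -/
def IndepTo {m n : ℕ} (Y : Fin n → Ω → ℝ) (X : Fin m → Ω → ℝ) : Prop :=
  ∀ φ : (Fin m → ℝ) × (Fin n → ℝ) → ℝ,
    (∃ K : ℝ≥0, LipschitzWith K φ) → (∃ C : ℝ, ∀ z, |φ z| ≤ C) →
    P.expect (fun ω => φ (fun i => X i ω, fun j => Y j ω)) =
      P.expect (fun ω =>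
        (P.expect (fun ω' => φ (fun i => X i ω, fun j => Y j ω'))).toReal)

/-- Independence of the sequence `X 0, X 1, …` of random variables: each `X (i + 1)` is independent
to `(X 0, …, X i)`. -/
def IndepSeq (X : ℕ → Ω → ℝ) : Prop :=
  ∀ i : ℕ, P.IndepTo (fun _ : Fin 1 => X (i + 1)) (fun j : Fin (i + 1) => X j)

/-- Tightness: `𝕍(|S| > x) → 0` as `x → ∞`. -/
def Tight (S : Ω → ℝ) : Prop :=
  Tendsto (fun x : ℝ => P.capacity {ω | x < |S ω|}) atTop (𝓝 0)

/-- `S n → L` in capacity. -/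
def TendstoInCapacity (S : ℕ → Ω → ℝ) (L : Ω → ℝ) : Prop :=
  ∀ ε : ℝ, 0 < ε →
    Tendsto (fun n => P.capacity {ω | ε ≤ |S n ω - L ω|}) atTop (𝓝 0)

/-- `S n` is a Cauchy sequence in capacity. -/
def CauchyInCapacity (S : ℕ → Ω → ℝ) : Prop :=
  ∀ ε : ℝ, 0 < ε →
    Tendsto (fun p : ℕ × ℕ => P.capacity {ω | ε ≤ |S p.1 ω - S p.2 ω|}) atTop (𝓝 0)

/-- `S n → L` almost surely in capacity: the set where `S n ω` does not converge to `L ω` has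
capacity zero. -/
def TendstoAlmostSurely (S : ℕ → Ω → ℝ) (L : Ω → ℝ) : Prop :=
  P.capacity {ω | ¬ Tendsto (fun n => S n ω) atTop (𝓝 (L ω))} = 0

end SublinearSpace

/-- Partial sums `S n = X 0 + ⋯ + X (n - 1)`, the sum of the first `n` terms. -/
def partialSum {Ω : Type u} (X : ℕ → Ω → ℝ) (n : ℕ) (ω : Ω) : ℝ :=
  ∑ i ∈ Finset.range n, X i ω

/-! For bounded functions everything is done with the real-valued functional `ex`, which is
monotone, sub-additive, positively homogeneous and translation invariant. Part (i) is then the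
classical argument: truncate by tightness and use uniform continuity on a compact interval.

For the Cauchy property, let Y = S_n - S_m and (Tψ)(x) = 𝔼[ψ(x + Y)]. Independence gives 𝔼[ψ(S_n)] =
𝔼[(Tψ)(S_m)], while convergence in distribution is uniform over [0,1]-valued functions with a common
Lipschitz constant (`eventually_abs_ex_sub_le`). T preserves that class, so each application of T
changes 𝔼[ψ(S_m)] only slightly. Thus the random walk with steps distributed as Y stays tight for
any prescribed number of steps once m is large. A walk whose steps exceed ε in one direction with
capacity at least δ must escape (`false_of_iterate_trans_cutoff_le`), so 𝕍(Y ≥ ε) and 𝕍(-Y ≥ ε) are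
eventually below δ. No centring, moments or characteristic functions enter.

For the almost sure limit, an Ottaviani-type inequality (`IndepSeq.cap_exists_le`) turns the Cauchy
property into control of maxima over blocks, and countable sub-additivity gives a Borel–Cantelli
argument. -/

namespace SublinearSpace

variable {Ω : Type u} [MeasurableSpace Ω] (P : SublinearSpace Ω)

/-! ### The expectation on bounded functions -/

/-- The real-valued expectation, meaningful on bounded functions. -/
noncomputable def ex (f : Ω → ℝ) : ℝ := (P.expect f).toReal

/-- The real-valued capacity. -/
noncomputable def cap (A : Set Ω) : ℝ := P.ex (A.indicator fun _ => 1)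

theorem expect_mono {f g : Ω → ℝ} (h : ∀ ω, f ω ≤ g ω) : P.expect f ≤ P.expect g :=
  le_iInf₂ fun Y hY => iInf₂_le Y fun ω => (h ω).trans (hY ω)

theorem expect_const (c : ℝ) : P.expect (fun _ => c) = c := by
  have := P.expect_coe ⟨_, P.const_mem c⟩
  rw [P.const c ⟨_, P.const_mem c⟩ fun _ => rfl] at this
  exact this

/-- Boundedness of a real function. -/
def Bdd {α : Type*} (f : α → ℝ) : Prop := ∃ C : ℝ, ∀ a, |f a| ≤ C

theorem Bdd.const {α : Type*} (c : ℝ) : Bdd fun _ : α => c := ⟨|c|, fun _ => le_rfl⟩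

theorem Bdd.add {α : Type*} {f g : α → ℝ} (hf : Bdd f) (hg : Bdd g) :
    Bdd fun a => f a + g a := by
  obtain ⟨C, hC⟩ := hf
  obtain ⟨D, hD⟩ := hg
  exact ⟨C + D, fun a => (abs_add_le _ _).trans (add_le_add (hC a) (hD a))⟩

theorem Bdd.mul {α : Type*} {f g : α → ℝ} (hf : Bdd f) (hg : Bdd g) :
    Bdd fun a => f a * g a := by
  obtain ⟨C, hC⟩ := hf
  obtain ⟨D, hD⟩ := hg
  refine ⟨C * D, fun a => ?_⟩
  rw [abs_mul]
  exact mul_le_mul (hC a) (hD a) (abs_nonneg _) ((abs_nonneg _).trans (hC a))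

theorem Bdd.sub {α : Type*} {f g : α → ℝ} (hf : Bdd f) (hg : Bdd g) :
    Bdd fun a => f a - g a := by
  obtain ⟨C, hC⟩ := hf
  obtain ⟨D, hD⟩ := hg
  exact ⟨C + D, fun a => (abs_sub _ _).trans (add_le_add (hC a) (hD a))⟩

theorem Bdd.comp {α β : Type*} {f : α → ℝ} (hf : Bdd f) (g : β → α) : Bdd fun b => f (g b) :=
  hf.imp fun _ h b => h (g b)

theorem Bdd.of_mem {α : Type*} {f : α → ℝ} (h : ∀ a, 0 ≤ f a ∧ f a ≤ 1) : Bdd f :=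
  ⟨1, fun a => abs_le.2 ⟨by linarith [(h a).1], (h a).2⟩⟩

theorem indicator_mem {α : Type*} (A : Set α) (a : α) :
    0 ≤ A.indicator (fun _ => (1 : ℝ)) a ∧ A.indicator (fun _ => (1 : ℝ)) a ≤ 1 :=
  ⟨Set.indicator_nonneg (fun _ _ => zero_le_one) a,
    Set.indicator_le_self' (fun _ _ => zero_le_one) a⟩

theorem Bdd.indicator {α : Type*} (A : Set α) : Bdd (A.indicator fun _ => (1 : ℝ)) :=
  Bdd.of_mem (indicator_mem A)

variable {P}

theorem Bdd.expect_mem {f : Ω → ℝ} (hf : Bdd f) :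
    P.expect f ≠ ⊤ ∧ P.expect f ≠ ⊥ := by
  obtain ⟨C, hC⟩ := hf
  have h1 := P.expect_mono (g := fun _ => C) fun ω => (abs_le.1 (hC ω)).2
  have h2 := P.expect_mono (f := fun _ => -C) fun ω => (abs_le.1 (hC ω)).1
  rw [expect_const] at h1 h2
  exact ⟨ne_top_of_le_ne_top (EReal.coe_ne_top _) h1, ne_bot_of_le_ne_bot (EReal.coe_ne_bot _) h2⟩

theorem Bdd.coe_ex {f : Ω → ℝ} (hf : Bdd f) : (P.ex f : EReal) = P.expect f :=
  EReal.coe_toReal hf.expect_mem.1 hf.expect_mem.2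

variable (P)

theorem ex_const (c : ℝ) : P.ex (fun _ => c) = c := by rw [ex, expect_const, EReal.toReal_coe]

variable {P}

theorem ex_mono {f g : Ω → ℝ} (hf : Bdd f) (hg : Bdd g) (h : ∀ ω, f ω ≤ g ω) :
    P.ex f ≤ P.ex g := by
  rw [← EReal.coe_le_coe_iff, hf.coe_ex, hg.coe_ex]
  exact P.expect_mono h

/-- The bounded functions have nearly optimal majorants in `ℋ` of finite expectation. -/
theorem exists_majorant {f : Ω → ℝ} (hf : Bdd f) {a : ℝ} (ha : P.ex f < a) :
    ∃ (Y : P.H) (b : ℝ), (∀ ω, f ω ≤ (Y : Ω → ℝ) ω) ∧ P.E Y = b ∧ b < a := by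
  rw [← EReal.coe_lt_coe_iff, hf.coe_ex, expect] at ha
  simp only [iInf_lt_iff] at ha
  obtain ⟨Y, hY, hlt⟩ := ha
  have h1 : P.expect f ≤ P.E Y := iInf₂_le Y hY
  have h2 : P.E Y ≠ ⊥ := ne_bot_of_le_ne_bot hf.expect_mem.2 h1
  have h3 : P.E Y ≠ ⊤ := ne_top_of_lt hlt
  have h4 := EReal.coe_toReal h3 h2
  exact ⟨Y, (P.E Y).toReal, hY, h4.symm, by rwa [← EReal.coe_lt_coe_iff, h4]⟩

theorem ex_le_of_majorant {f : Ω → ℝ} (hf : Bdd f) {Y : P.H} (hY : ∀ ω, f ω ≤ (Y : Ω → ℝ) ω)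
    {b : ℝ} (hb : P.E Y ≤ b) : P.ex f ≤ b := by
  rw [← EReal.coe_le_coe_iff, hf.coe_ex]
  exact (iInf₂_le Y hY).trans hb

/-- Sub-additivity on ℋ passes to the infimum through nearly optimal majorants; their expectations
are finite, so the ∞ - ∞ proviso is harmless. -/
theorem ex_add_le {f g : Ω → ℝ} (hf : Bdd f) (hg : Bdd g) :
    P.ex (fun ω => f ω + g ω) ≤ P.ex f + P.ex g := by
  refine le_of_forall_pos_le_add fun ε hε => ?_
  obtain ⟨Y, b, hY, hb, hlt⟩ := exists_majorant hf (show P.ex f < P.ex f + ε / 2 by linarith)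
  obtain ⟨Z, c, hZ, hc, hlt'⟩ := exists_majorant hg (show P.ex g < P.ex g + ε / 2 by linarith)
  have h := P.subadd Y Z (by simp [hb]) (by simp [hb])
  rw [hb, hc, ← EReal.coe_add] at h
  have := ex_le_of_majorant (hf.add hg) (Y := Y + Z) (fun ω => add_le_add (hY ω) (hZ ω)) h
  linarith

theorem ex_const_mul_le {f : Ω → ℝ} (hf : Bdd f) {c : ℝ} (hc : 0 < c) :
    P.ex (fun ω => c * f ω) ≤ c * P.ex f := by
  refine le_of_forall_pos_le_add fun ε hε => ?_
  obtain ⟨Y, b, hY, hb, hlt⟩ := exists_majorant hf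
    (show P.ex f < P.ex f + ε / c by linarith [div_pos hε hc])
  have h := P.pos_homog c Y hc.le
  rw [hb, ← EReal.coe_mul] at h
  have h1 := ex_le_of_majorant ((Bdd.const c).mul hf) (Y := c • Y)
    (fun ω => mul_le_mul_of_nonneg_left (hY ω) hc.le) h.le
  have h2 : c * b ≤ c * (P.ex f + ε / c) := mul_le_mul_of_nonneg_left hlt.le hc.le
  rw [mul_add, mul_div_cancel₀ _ hc.ne'] at h2
  exact h1.trans h2

theorem ex_const_mul {f : Ω → ℝ} (hf : Bdd f) {c : ℝ} (hc : 0 ≤ c) :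
    P.ex (fun ω => c * f ω) = c * P.ex f := by
  rcases hc.eq_or_lt with rfl | hc
  · simpa using P.ex_const 0
  refine (ex_const_mul_le hf hc).antisymm ?_
  have := ex_const_mul_le (P := P) ((Bdd.const c).mul hf) (inv_pos.2 hc)
  simp only [inv_mul_cancel_left₀ hc.ne'] at this
  calc c * P.ex f ≤ c * (c⁻¹ * P.ex fun ω => c * f ω) := mul_le_mul_of_nonneg_left this hc.le
    _ = _ := mul_inv_cancel_left₀ hc.ne' _

/-- Sub-additivity used with both c and -c forces equality. -/
theorem ex_const_add {f : Ω → ℝ} (hf : Bdd f) (c : ℝ) :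
    P.ex (fun ω => c + f ω) = c + P.ex f := by
  have h1 := ex_add_le (P := P) (Bdd.const c) hf
  have h2 := ex_add_le (P := P) (Bdd.const (-c)) ((Bdd.const c).add hf)
  simp only [neg_add_cancel_left, ex_const] at h1 h2
  linarith

theorem ex_le_add {f g h : Ω → ℝ} (hf : Bdd f) (hg : Bdd g) (hh : Bdd h)
    (H : ∀ ω, f ω ≤ g ω + h ω) : P.ex f ≤ P.ex g + P.ex h :=
  (ex_mono hf (hg.add hh) H).trans (ex_add_le hg hh)

theorem ex_add_mul_indicator (a : ℝ) {b : ℝ} (hb : 0 ≤ b) (A : Set Ω) :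
    P.ex (fun ω => a + b * A.indicator (fun _ => 1) ω) = a + b * P.cap A := by
  rw [ex_const_add ((Bdd.const b).mul (Bdd.indicator A)), ex_const_mul (Bdd.indicator A) hb, cap]

theorem abs_ex_sub_le {f g : Ω → ℝ} (hf : Bdd f) (hg : Bdd g) {a b : ℝ} (hb : 0 ≤ b) (A : Set Ω)
    (H : ∀ ω, |f ω - g ω| ≤ a + b * A.indicator (fun _ => 1) ω) :
    |P.ex f - P.ex g| ≤ a + b * P.cap A := by
  have hB : Bdd fun ω => a + b * A.indicator (fun _ => 1) ω :=
    (Bdd.const a).add ((Bdd.const b).mul (Bdd.indicator A))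
  have h1 := ex_le_add (P := P) hf hg hB fun ω => by linarith [(abs_le.1 (H ω)).2]
  have h2 := ex_le_add (P := P) hg hf hB fun ω => by linarith [(abs_le.1 (H ω)).1]
  rw [ex_add_mul_indicator a hb] at h1 h2
  exact abs_le.2 ⟨by linarith, by linarith⟩

theorem abs_ex_sub_le_const {f g : Ω → ℝ} (hf : Bdd f) (hg : Bdd g) {a : ℝ}
    (H : ∀ ω, |f ω - g ω| ≤ a) : |P.ex f - P.ex g| ≤ a := by
  simpa using abs_ex_sub_le (P := P) hf hg le_rfl ∅ (a := a) fun ω => by simpa using H ω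

theorem ex_mem {f : Ω → ℝ} (h : ∀ ω, 0 ≤ f ω ∧ f ω ≤ 1) : 0 ≤ P.ex f ∧ P.ex f ≤ 1 := by
  have h0 := ex_mono (P := P) (Bdd.const 0) (Bdd.of_mem h) fun ω => (h ω).1
  have h1 := ex_mono (P := P) (Bdd.of_mem h) (Bdd.const 1) fun ω => (h ω).2
  rw [ex_const] at h0 h1
  exact ⟨h0, h1⟩

theorem abs_ex_le {f : Ω → ℝ} {C : ℝ} (h : ∀ ω, |f ω| ≤ C) : |P.ex f| ≤ C := by
  simpa [ex_const] using abs_ex_sub_le_const (P := P) ⟨C, h⟩ (Bdd.const 0) (a := C) (by simpa)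

/-! ### Capacities -/

theorem cap_mem (A : Set Ω) : 0 ≤ P.cap A ∧ P.cap A ≤ 1 := ex_mem (indicator_mem A)

theorem cap_mono {A B : Set Ω} (h : A ⊆ B) : P.cap A ≤ P.cap B :=
  ex_mono (Bdd.indicator A) (Bdd.indicator B) fun _ =>
    Set.indicator_le_indicator_of_subset h (fun _ => zero_le_one) _

theorem cap_union_le (A B : Set Ω) : P.cap (A ∪ B) ≤ P.cap A + P.cap B := by
  refine ex_le_add (Bdd.indicator _) (Bdd.indicator _) (Bdd.indicator _) fun ω => ?_
  by_cases hA : ω ∈ A <;> by_cases hB : ω ∈ B <;> simp [hA, hB]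

theorem cap_le_ex {A : Set Ω} {f : Ω → ℝ} (hf : Bdd f) (h0 : ∀ ω, 0 ≤ f ω)
    (h1 : ∀ ω ∈ A, 1 ≤ f ω) : P.cap A ≤ P.ex f :=
  ex_mono (Bdd.indicator A) hf fun ω => Set.indicator_le' h1 (fun _ _ => h0 _) ω

theorem ex_le_cap {A : Set Ω} {f : Ω → ℝ} (hf : Bdd f) (h0 : ∀ ω ∉ A, f ω ≤ 0)
    (h1 : ∀ ω, f ω ≤ 1) : P.ex f ≤ P.cap A := by
  refine ex_mono hf (Bdd.indicator A) fun ω => ?_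
  by_cases hA : ω ∈ A
  · simpa [hA] using h1 ω
  · simpa [hA] using h0 ω hA

theorem capacity_eq (A : Set Ω) : P.capacity A = ENNReal.ofReal (P.cap A) := by
  rw [capacity, EReal.toENNReal, if_neg (Bdd.indicator A).expect_mem.1]
  rfl

theorem tendsto_capacity_zero_iff {ι : Type*} {l : Filter ι} {A : ι → Set Ω} :
    Tendsto (fun i => P.capacity (A i)) l (𝓝 0) ↔ ∀ τ : ℝ, 0 < τ → ∀ᶠ i in l, P.cap (A i) < τ := by
  constructor
  · intro h τ hτ
    filter_upwards [h.eventually_lt_const (ENNReal.ofReal_pos.2 hτ)] with i hi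
    rw [capacity_eq] at hi
    exact (ENNReal.ofReal_lt_ofReal_iff hτ).1 hi
  · intro h
    have : Tendsto (fun i => P.cap (A i)) l (𝓝 0) :=
      tendsto_order.2 ⟨fun a ha => Eventually.of_forall fun i => ha.trans_le (cap_mem _).1, h⟩
    simpa [capacity_eq] using ENNReal.tendsto_ofReal this

end SublinearSpace

namespace SublinearSpace

variable {Ω : Type u} [MeasurableSpace Ω] {P : SublinearSpace Ω}

/-! ### Convergence in capacity implies convergence in distribution -/

theorem tendsto_expect_iff {ι : Type*} {l : Filter ι} {f : ι → Ω → ℝ} (hf : ∀ i, Bdd (f i))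
    {Ω' : Type v} [MeasurableSpace Ω'] {P' : SublinearSpace Ω'} {g : Ω' → ℝ} (hg : Bdd g) :
    Tendsto (fun i => P.expect (f i)) l (𝓝 (P'.expect g)) ↔
      Tendsto (fun i => P.ex (f i)) l (𝓝 (P'.ex g)) := by
  rw [← hg.coe_ex, ← EReal.tendsto_coe]
  simp only [(hf _).coe_ex]

theorem bdd_bcf (φ : BoundedContinuousFunction ℝ ℝ) : Bdd φ := ⟨‖φ‖, φ.norm_coe_le_norm⟩

theorem TendstoInCapacity.tendsto_expect {Z : ℕ → Ω → ℝ} {S : Ω → ℝ}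
    (hZ : P.TendstoInCapacity Z S) (hS : P.Tight S) (φ : BoundedContinuousFunction ℝ ℝ) :
    Tendsto (fun n => P.expect (fun ω => φ (Z n ω))) atTop
      (𝓝 (P.expect (fun ω => φ (S ω)))) := by
  rw [tendsto_expect_iff (fun n => (bdd_bcf φ).comp _) ((bdd_bcf φ).comp _), Metric.tendsto_atTop']
  intro ε hε
  obtain ⟨M, hM0, hM⟩ : ∃ M : ℝ, 0 < M ∧ ∀ x, |φ x| ≤ M :=
    ⟨‖φ‖ + 1, by positivity, fun x => (φ.norm_coe_le_norm x).trans (by linarith)⟩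
  -- Two exceptional sets of this capacity, on which φ varies by at most 2M, cost ε / 2 together.
  have hτ : 0 < ε / (8 * M) := by positivity
  obtain ⟨x, hx⟩ := (tendsto_capacity_zero_iff.1 hS _ hτ).exists
  have huc : UniformContinuousOn φ (Set.Icc (-(x + 1)) (x + 1)) :=
    isCompact_Icc.uniformContinuousOn_of_continuous φ.continuous.continuousOn
  obtain ⟨δ, hδ, huc⟩ := Metric.uniformContinuousOn_iff.1 huc (ε / 2) (half_pos hε)
  -- The bound 1 keeps `Z n` in [-(x + 1), x + 1] whenever |S| ≤ x; the bound δ serves uniform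
  -- continuity.
  obtain ⟨N, hN⟩ := eventually_atTop.1
    (tendsto_capacity_zero_iff.1 (hZ (min δ 1) (by positivity)) _ hτ)
  refine ⟨N, fun n hn => ?_⟩
  have hcap := cap_union_le (P := P) {ω | x < |S ω|} {ω | min δ 1 ≤ |Z n ω - S ω|}
  have key := abs_ex_sub_le (P := P) (f := fun ω => φ (Z n ω)) (g := fun ω => φ (S ω))
    ((bdd_bcf φ).comp _) ((bdd_bcf φ).comp _) (a := ε / 2) (b := 2 * M) (by positivity)
    ({ω | x < |S ω|} ∪ {ω | min δ 1 ≤ |Z n ω - S ω|}) fun ω => by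
      by_cases h : ω ∈ {ω | x < |S ω|} ∪ {ω | min δ 1 ≤ |Z n ω - S ω|}
      · rw [Set.indicator_of_mem h]
        have h1 := abs_le.1 (hM (Z n ω))
        have h2 := abs_le.1 (hM (S ω))
        exact abs_le.2 ⟨by linarith, by linarith⟩
      · rw [Set.indicator_of_notMem h]
        simp only [Set.mem_union, Set.mem_ofPred_eq, not_or, not_lt, not_le, lt_min_iff] at h
        obtain ⟨h1, h2, h3⟩ := h
        have h4 := abs_le.1 h1
        have h5 := abs_lt.1 h3
        have := huc (Z n ω) ⟨by linarith, by linarith⟩ (S ω) ⟨by linarith, by linarith⟩ h2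
        rw [Real.dist_eq] at this
        linarith
  rw [Real.dist_eq]
  have h1 : 2 * M * P.cap ({ω | x < |S ω|} ∪ {ω | min δ 1 ≤ |Z n ω - S ω|}) <
      2 * M * (ε / (8 * M) + ε / (8 * M)) :=
    mul_lt_mul_of_pos_left (by linarith [hN n hn.le]) (by positivity)
  have h2 : 2 * M * (ε / (8 * M) + ε / (8 * M)) = ε / 2 := by field_simp; ring
  linarith

/-! ### Cut-off functions -/

/-- The cut-off function which is `0` on `[-L, L]` and `1` outside `(-2L, 2L)`. -/
noncomputable def cutoff (L x : ℝ) : ℝ := max 0 (min 1 (L⁻¹ * |x| - 1))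

theorem cutoff_mem (L x : ℝ) : 0 ≤ cutoff L x ∧ cutoff L x ≤ 1 :=
  ⟨le_max_left _ _, max_le zero_le_one (min_le_left _ _)⟩

theorem cutoff_eq_zero {L x : ℝ} (hL : 0 < L) (h : |x| ≤ L) : cutoff L x = 0 := by
  refine max_eq_left ((min_le_right _ _).trans ?_)
  have : L⁻¹ * |x| ≤ L⁻¹ * L := mul_le_mul_of_nonneg_left h (by positivity)
  rw [inv_mul_cancel₀ hL.ne'] at this
  linarith

theorem cutoff_eq_one {L x : ℝ} (hL : 0 < L) (h : 2 * L ≤ |x|) : cutoff L x = 1 := by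
  have h1 : L⁻¹ * (2 * L) ≤ L⁻¹ * |x| := mul_le_mul_of_nonneg_left h (by positivity)
  have h2 : L⁻¹ * (2 * L) = 2 := by field_simp
  rw [cutoff, min_eq_left (by linarith), max_eq_right zero_le_one]

theorem lipschitzWith_cutoff {L : ℝ} (hL : 0 < L) : LipschitzWith (Real.toNNReal L⁻¹) (cutoff L) := by
  have h : LipschitzWith (Real.toNNReal L⁻¹) fun x : ℝ => L⁻¹ * |x| - 1 := by
    refine LipschitzWith.of_dist_le_mul fun x y => ?_
    rw [Real.dist_eq, Real.dist_eq, Real.coe_toNNReal _ (by positivity),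
      show L⁻¹ * |x| - 1 - (L⁻¹ * |y| - 1) = L⁻¹ * (|x| - |y|) by ring, abs_mul,
      abs_of_pos (by positivity : 0 < L⁻¹)]
    exact mul_le_mul_of_nonneg_left (abs_abs_sub_abs_le_abs_sub x y) (by positivity)
  exact (h.const_min 1).const_max 0

/-- The cut-off as a bounded continuous function. -/
noncomputable def cutoffBCF {L : ℝ} (hL : 0 < L) : BoundedContinuousFunction ℝ ℝ :=
  BoundedContinuousFunction.ofNormedAddCommGroup (cutoff L) (lipschitzWith_cutoff hL).continuous 1
    fun x => by rw [Real.norm_eq_abs, abs_of_nonneg (cutoff_mem L x).1]; exact (cutoff_mem L x).2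

/-! ### The transition operator of a random variable -/

variable (P) in
/-- The operator `ψ ↦ 𝔼[ψ(· + Y)]`. -/
noncomputable def trans (Y : Ω → ℝ) (ψ : ℝ → ℝ) (x : ℝ) : ℝ := P.ex fun ω => ψ (x + Y ω)

theorem trans_mem (Y : Ω → ℝ) {ψ : ℝ → ℝ} (h : ∀ x, 0 ≤ ψ x ∧ ψ x ≤ 1) (x : ℝ) :
    0 ≤ P.trans Y ψ x ∧ P.trans Y ψ x ≤ 1 := ex_mem fun _ => h _

theorem lipschitzWith_trans (Y : Ω → ℝ) {ψ : ℝ → ℝ} (h : Bdd ψ) {K : ℝ≥0}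
    (hK : LipschitzWith K ψ) : LipschitzWith K (P.trans Y ψ) :=
  LipschitzWith.of_dist_le_mul fun x y => abs_ex_sub_le_const (h.comp _) (h.comp _) fun ω => by
    simpa [Real.dist_eq] using hK.dist_le_mul (x + Y ω) (y + Y ω)

theorem iterate_trans_mem (Y : Ω → ℝ) {ψ : ℝ → ℝ} (h : ∀ x, 0 ≤ ψ x ∧ ψ x ≤ 1) (n : ℕ) :
    ∀ x, 0 ≤ (P.trans Y)^[n] ψ x ∧ (P.trans Y)^[n] ψ x ≤ 1 := by
  induction n with
  | zero => exact h
  | succ n ih => rw [Function.iterate_succ_apply']; exact trans_mem Y ih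

/-- The constant does not grow with n, so all iterates lie in one class on which convergence in
distribution is uniform. -/
theorem lipschitzWith_iterate_trans (Y : Ω → ℝ) {ψ : ℝ → ℝ} (h : ∀ x, 0 ≤ ψ x ∧ ψ x ≤ 1)
    {K : ℝ≥0} (hK : LipschitzWith K ψ) (n : ℕ) : LipschitzWith K ((P.trans Y)^[n] ψ) := by
  induction n with
  | zero => exact hK
  | succ n ih =>
    rw [Function.iterate_succ_apply']
    exact lipschitzWith_trans Y (Bdd.of_mem (iterate_trans_mem Y h n)) ih

/-- `trans` is monotone and commutes with translations. -/
theorem iterate_trans_shift_le (Y : Ω → ℝ) {φ χ : ℝ → ℝ} (hφ : ∀ x, 0 ≤ φ x ∧ φ x ≤ 1)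
    (hχ : ∀ x, 0 ≤ χ x ∧ χ x ≤ 1) {x : ℝ} (h : ∀ y, χ y ≤ φ (x + y)) (n : ℕ) :
    ∀ y, (P.trans Y)^[n] χ y ≤ (P.trans Y)^[n] φ (x + y) := by
  induction n with
  | zero => exact h
  | succ n ih =>
    intro y
    simp only [Function.iterate_succ_apply', trans]
    refine ex_mono ((Bdd.of_mem (iterate_trans_mem Y hχ n)).comp _)
      ((Bdd.of_mem (iterate_trans_mem Y hφ n)).comp _) fun ω => ?_
    rw [add_assoc]
    exact ih _

/-- Sub-additivity stands in for additivity here: 1 = 𝔼[1] is at most the sum of the two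
expectations at each step. -/
theorem one_le_iterate_trans_shift_add (Y : Ω → ℝ) {φ χ : ℝ → ℝ} (hφ : ∀ x, 0 ≤ φ x ∧ φ x ≤ 1)
    (hχ : ∀ x, 0 ≤ χ x ∧ χ x ≤ 1) {x : ℝ} (h : ∀ y, 1 ≤ φ (x + y) + χ y) (n : ℕ) :
    ∀ y, 1 ≤ (P.trans Y)^[n] φ (x + y) + (P.trans Y)^[n] χ y := by
  induction n with
  | zero => exact h
  | succ n ih =>
    intro y
    simp only [Function.iterate_succ_apply', trans]
    have := ex_le_add (P := P) (Bdd.const 1)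
      ((Bdd.of_mem (iterate_trans_mem Y hφ n)).comp fun ω => x + y + Y ω)
      ((Bdd.of_mem (iterate_trans_mem Y hχ n)).comp fun ω => y + Y ω) fun ω => by
        rw [add_assoc]
        exact ih _
    rwa [ex_const] at this

/-- A random walk with steps exceeding `ε` with capacity at least `δ` leaves each interval; so if
the walk stays tight over `l * N` steps, with `N * ε` exceeding the length of the interval, then
`l` is bounded in terms of `δ` and `N`. -/
theorem false_of_iterate_trans_cutoff_le (Y : Ω → ℝ) {s ε δ M : ℝ} (hs : s = 1 ∨ s = -1)
    (hM : 0 < M) (hδ : 0 ≤ δ) (hcap : δ ≤ P.cap {ω | ε ≤ s * Y ω}) {N l : ℕ}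
    (hN : 8 * M ≤ N * ε) (hl : (1 - δ ^ N) ^ l < 1 / 2)
    (hT : ∀ i ≤ l * N, (P.trans Y)^[i] (cutoff M) 0 ≤ 1 / 4) : False := by
  have hδ1 : δ ≤ 1 := hcap.trans (cap_mem _).2
  have hmem := iterate_trans_mem (P := P) Y (cutoff_mem M)
  have habs : ∀ x, |x| = |s * x| := fun x => by rcases hs with rfl | rfl <;> simp
  -- A walk from the origin rarely moves by 2M, by `hT`; hence one started at distance 4M mostly
  -- stays outside (-2M, 2M).
  have hfar : ∀ i ≤ l * N, ∀ x, 4 * M ≤ |s * x| → 3 / 4 ≤ (P.trans Y)^[i] (cutoff M) x := by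
    intro i hi x hx
    rw [← habs] at hx
    have := one_le_iterate_trans_shift_add (P := P) Y (cutoff_mem M) (cutoff_mem M) (x := x)
      (fun y => by
        rcases le_total (2 * M) |y| with hy | hy
        · rw [cutoff_eq_one hM hy]
          linarith [(cutoff_mem M (x + y)).1]
        · rw [cutoff_eq_one hM (x := x + y)]
          · linarith [(cutoff_mem M y).1]
          · have := abs_sub_abs_le_abs_sub x (-y)
            rw [abs_neg, sub_neg_eq_add] at this
            linarith) i 0
    rw [add_zero] at this
    linarith [hT i hi]
  have hmono : ∀ j a, (∀ x, a ≤ (P.trans Y)^[j] (cutoff M) x) →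
      ∀ r x, a ≤ (P.trans Y)^[j + r] (cutoff M) x := by
    intro j a ha r
    induction r with
    | zero => exact ha
    | succ r ih =>
      intro x
      rw [← add_assoc, Function.iterate_succ_apply']
      have := ex_mono (P := P) (Bdd.const a)
        ((Bdd.of_mem (hmem (j + r))).comp fun ω => x + Y ω) fun ω => ih _
      rwa [ex_const] at this
  -- At most r steps of size ε in direction s carry x beyond 4M, where the value is at least 3/4.
  -- Each such step has capacity at least δ, and off that event the uniform bound a persists by
  -- `hmono`.
  have hgain : ∀ j a, a ≤ 3 / 4 → (∀ x, a ≤ (P.trans Y)^[j] (cutoff M) x) →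
      ∀ r, j + r ≤ l * N → ∀ x, 4 * M - r * ε ≤ s * x →
        a + δ ^ r * (3 / 4 - a) ≤ (P.trans Y)^[j + r] (cutoff M) x := by
    intro j a ha hja r
    induction r with
    | zero =>
      intro hr x hx
      have := hfar j hr x ((by simpa using hx : 4 * M ≤ s * x).trans (le_abs_self _))
      simpa using this
    | succ r ih =>
      intro hr x hx
      have hb : 0 ≤ δ ^ r * (3 / 4 - a) := mul_nonneg (pow_nonneg hδ r) (by linarith)
      have h1 := ex_mono (P := P) (f := fun ω => a + δ ^ r * (3 / 4 - a) *
          Set.indicator {ω | ε ≤ s * Y ω} (fun _ => 1) ω)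
        ((Bdd.const a).add ((Bdd.const _).mul (Bdd.indicator _)))
        ((Bdd.of_mem (hmem (j + r))).comp fun ω => x + Y ω) fun ω => by
          by_cases hω : ω ∈ {ω | ε ≤ s * Y ω}
          · rw [Set.indicator_of_mem hω, mul_one]
            refine ih (by omega) _ ?_
            simp only [Set.mem_ofPred_eq] at hω
            push_cast at hx
            linarith
          · rw [Set.indicator_of_notMem hω, mul_zero, add_zero]
            exact hmono j a hja r _
      rw [ex_add_mul_indicator a hb] at h1
      have h2 := mul_le_mul_of_nonneg_left hcap hb
      rw [← add_assoc, Function.iterate_succ_apply', pow_succ]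
      change _ ≤ P.ex _
      linarith
  -- Each block of N steps multiplies the deficit below 3/4 by 1 - δ ^ N. After l blocks the value
  -- at 0 exceeds 3/8, against the bound 1/4.
  have hblock : ∀ i ≤ l, ∀ x,
      3 / 4 * (1 - (1 - δ ^ N) ^ i) ≤ (P.trans Y)^[i * N] (cutoff M) x := by
    intro i
    induction i with
    | zero => intro _ x; simpa using (cutoff_mem M x).1
    | succ i ih =>
      intro hi x
      have hle : i * N + N ≤ l * N := by
        rw [← Nat.succ_mul]
        exact Nat.mul_le_mul_right N hi
      have hp : 0 ≤ (1 - δ ^ N) ^ i :=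
        pow_nonneg (by linarith [pow_le_one₀ hδ hδ1 (n := N)]) i
      have hp1 : (1 - δ ^ N) ^ (i + 1) = (1 - δ ^ N) ^ i * (1 - δ ^ N) := pow_succ _ _
      have hp2 : 0 ≤ (1 - δ ^ N) ^ (i + 1) :=
        pow_nonneg (by linarith [pow_le_one₀ hδ hδ1 (n := N)]) _
      rw [Nat.succ_mul]
      -- Since N ε ≥ 8M, a point too far back to gain satisfies s x ≤ -4M and is already far out.
      rcases le_total (4 * M - N * ε) (s * x) with hx | hx
      · have := hgain (i * N) _ (by linarith) (ih (by omega)) N hle x hx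
        refine le_trans (le_of_eq ?_) this
        rw [hp1]
        ring
      · have := hfar _ hle x (le_trans (by linarith) (neg_le_abs _))
        linarith
  have h1 := hblock l le_rfl 0
  have h2 := hT _ le_rfl
  linarith

/-! ### Uniform convergence over classes of Lipschitz functions -/

/-- Arzelà–Ascoli on [-R, R]; composing with the projection onto the interval extends the net to
bounded continuous functions on ℝ. -/
theorem exists_finite_net (K : ℝ≥0) {R η : ℝ} (hR : 0 ≤ R) (hη : 0 < η) :
    ∃ t : Set (BoundedContinuousFunction ℝ ℝ), t.Finite ∧ (∀ g ∈ t, ∀ x, 0 ≤ g x ∧ g x ≤ 1) ∧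
      ∀ ψ : ℝ → ℝ, LipschitzWith K ψ → (∀ x, 0 ≤ ψ x ∧ ψ x ≤ 1) →
        ∃ g ∈ t, ∀ x, |x| ≤ R → |ψ x - g x| ≤ η := by
  have hR' : -R ≤ R := by linarith
  let A : Set (BoundedContinuousFunction (Set.Icc (-R) R) ℝ) :=
    {f | LipschitzWith K f ∧ ∀ x, f x ∈ Set.Icc (0 : ℝ) 1}
  have hA : TotallyBounded A := by
    refine (BoundedContinuousFunction.arzela_ascoli _ (isCompact_Icc (a := (0 : ℝ)) (b := 1)) A
      (fun f x hf => hf.2 x) ?_).totallyBounded.subset subset_closure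
    exact (LipschitzWith.uniformEquicontinuous _ K fun f => f.2.1).equicontinuous
  obtain ⟨t, htA, htf, ht⟩ := Metric.finite_approx_of_totallyBounded hA η hη
  refine ⟨(fun f => f.compContinuous ⟨_, continuous_projIcc (h := hR')⟩) '' t, htf.image _, ?_, ?_⟩
  · rintro _ ⟨f, hf, rfl⟩ x
    exact (htA hf).2 _
  · intro ψ hψ h01
    let f : BoundedContinuousFunction (Set.Icc (-R) R) ℝ :=
      BoundedContinuousFunction.mkOfCompact ⟨fun x => ψ x, by
        have := hψ.continuous
        fun_prop⟩
    have hf : f ∈ A := ⟨fun x y => hψ x y, fun x => h01 x⟩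
    obtain ⟨g, hg, hfg⟩ := Set.mem_iUnion₂.1 (ht hf)
    refine ⟨_, ⟨g, hg, rfl⟩, fun x hx => ?_⟩
    have h1 := (BoundedContinuousFunction.dist_coe_le_dist (f := f) (g := g)
      ⟨x, abs_le.1 hx⟩).trans (Metric.mem_ball.1 hfg).le
    have h2 : Set.projIcc (-R) R hR' x = ⟨x, abs_le.1 hx⟩ := Set.projIcc_of_mem hR' _
    change |ψ x - g (Set.projIcc (-R) R hR' x)| ≤ η
    rw [h2]
    exact h1

section Distribution

variable {Z : ℕ → Ω → ℝ} {Ω' : Type v} [MeasurableSpace Ω'] {P' : SublinearSpace Ω'}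
  {S' : Ω' → ℝ}

/-- The cut-off lies between the indicators of |z| > 2x and |z| > x, so tightness of the limit
passes to the sequence. -/
theorem exists_cap_lt_of_tendsto (hS' : P'.Tight S')
    (h : ∀ φ : BoundedContinuousFunction ℝ ℝ, Tendsto (fun n => P.expect (fun ω => φ (Z n ω)))
      atTop (𝓝 (P'.expect (fun ω => φ (S' ω))))) {τ : ℝ} (hτ : 0 < τ) :
    ∃ L : ℝ, 0 < L ∧ ∀ᶠ n in atTop, P.cap {ω | L < |Z n ω|} < τ := by
  obtain ⟨x, hx, hx0⟩ := ((tendsto_capacity_zero_iff.1 hS' τ hτ).and (eventually_gt_atTop 0)).exists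
  refine ⟨2 * x, by linarith, ?_⟩
  have h1 := (tendsto_expect_iff (fun n => (bdd_bcf _).comp _) ((bdd_bcf _).comp _)).1
    (h (cutoffBCF hx0))
  have h2 : P'.ex (fun ω => cutoffBCF hx0 (S' ω)) < τ := by
    refine lt_of_le_of_lt (ex_le_cap ((bdd_bcf _).comp _) (fun ω hω => ?_)
      fun ω => (cutoff_mem x (S' ω)).2) hx
    exact (cutoff_eq_zero hx0 (not_lt.1 hω)).le
  filter_upwards [h1.eventually_lt_const h2] with n hn
  exact lt_of_le_of_lt (cap_le_ex ((bdd_bcf _).comp _) (fun ω => (cutoff_mem x (Z n ω)).1)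
    fun ω hω => (cutoff_eq_one hx0 (Set.mem_ofPred_eq ▸ hω).le).ge) hn

/-- Tightness reduces to a compact interval, and a finite net there reduces to finitely many test
functions. Replacing ψ by g costs η / 3 at each of m and n, and the distance to the limit η / 6 at
each. -/
theorem eventually_abs_ex_sub_le (hS' : P'.Tight S')
    (h : ∀ φ : BoundedContinuousFunction ℝ ℝ, Tendsto (fun n => P.expect (fun ω => φ (Z n ω)))
      atTop (𝓝 (P'.expect (fun ω => φ (S' ω))))) (K : ℝ≥0) {η : ℝ} (hη : 0 < η) :
    ∃ N : ℕ, ∀ m ≥ N, ∀ n ≥ N, ∀ ψ : ℝ → ℝ, LipschitzWith K ψ → (∀ x, 0 ≤ ψ x ∧ ψ x ≤ 1) →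
      |P.ex (fun ω => ψ (Z m ω)) - P.ex (fun ω => ψ (Z n ω))| ≤ η := by
  obtain ⟨L, hL, hcap⟩ := exists_cap_lt_of_tendsto (P := P) hS' h (show 0 < η / 6 by linarith)
  obtain ⟨t, htf, ht01, ht⟩ := exists_finite_net K hL.le (show 0 < η / 6 by linarith)
  have hconv : ∀ᶠ n in atTop, ∀ g ∈ t,
      |P.ex (fun ω => g (Z n ω)) - P'.ex (fun ω => g (S' ω))| < η / 6 := by
    refine (htf.eventually_all).2 fun g _ => ?_
    have := (tendsto_expect_iff (fun n => (bdd_bcf _).comp _) ((bdd_bcf _).comp _)).1 (h g)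
    exact (Metric.tendsto_nhds.1 this (η / 6) (by linarith)).mono fun n hn => hn
  obtain ⟨N, hN⟩ := eventually_atTop.1 (hcap.and hconv)
  refine ⟨N, fun m hm n hn ψ hψ h01 => ?_⟩
  obtain ⟨g, hg, hψg⟩ := ht ψ hψ h01
  have key : ∀ k ≥ N, |P.ex (fun ω => ψ (Z k ω)) - P.ex (fun ω => g (Z k ω))| ≤ η / 3 := by
    intro k hk
    have := abs_ex_sub_le (P := P) ((Bdd.of_mem h01).comp (Z k)) ((bdd_bcf g).comp (Z k))
      (a := η / 6) zero_le_one {ω | L < |Z k ω|} fun ω => by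
        by_cases hω : ω ∈ {ω | L < |Z k ω|}
        · rw [Set.indicator_of_mem hω]
          have h1 := h01 (Z k ω)
          have h2 := ht01 g hg (Z k ω)
          exact abs_le.2 ⟨by linarith, by linarith⟩
        · rw [Set.indicator_of_notMem hω]
          simpa using hψg _ (not_lt.1 hω)
    linarith [(hN k hk).1]
  have h1 := abs_le.1 (key m hm)
  have h2 := abs_le.1 (key n hn)
  have h3 := abs_lt.1 ((hN m hm).2 g hg)
  have h4 := abs_lt.1 ((hN n hn).2 g hg)
  exact abs_le.2 ⟨by linarith, by linarith⟩

end Distribution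

end SublinearSpace

namespace SublinearSpace

section Lipschitz

variable {Ω : Type u} {X : ℕ → Ω → ℝ}

/-! ### Lipschitz functions of finitely many variables -/

/-- `Z` is a Lipschitz function of `X 0, …, X (n - 1)`. -/
def LipOf (X : ℕ → Ω → ℝ) (n : ℕ) (Z : Ω → ℝ) : Prop :=
  ∃ (K : ℝ≥0) (q : (Fin n → ℝ) → ℝ), LipschitzWith K q ∧ ∀ ω, Z ω = q fun i => X i ω

theorem LipOf.const (n : ℕ) (c : ℝ) : LipOf X n fun _ => c :=
  ⟨0, fun _ => c, LipschitzWith.const c, fun _ => rfl⟩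

theorem LipOf.var {n i : ℕ} (h : i < n) : LipOf X n (X i) :=
  ⟨1, fun x => x ⟨i, h⟩, LipschitzWith.eval _, fun _ => rfl⟩

theorem LipOf.add {n : ℕ} {Z W : Ω → ℝ} (hZ : LipOf X n Z) (hW : LipOf X n W) :
    LipOf X n fun ω => Z ω + W ω := by
  obtain ⟨K, q, hq, hZq⟩ := hZ
  obtain ⟨K', q', hq', hWq⟩ := hW
  exact ⟨K + K', fun x => q x + q' x, hq.add hq', fun ω => by simp only [hZq, hWq]⟩

theorem LipOf.sub {n : ℕ} {Z W : Ω → ℝ} (hZ : LipOf X n Z) (hW : LipOf X n W) :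
    LipOf X n fun ω => Z ω - W ω := by
  obtain ⟨K, q, hq, hZq⟩ := hZ
  obtain ⟨K', q', hq', hWq⟩ := hW
  exact ⟨K + K', fun x => q x - q' x, hq.sub hq', fun ω => by simp only [hZq, hWq]⟩

theorem LipOf.max {n : ℕ} {Z W : Ω → ℝ} (hZ : LipOf X n Z) (hW : LipOf X n W) :
    LipOf X n fun ω => Max.max (Z ω) (W ω) := by
  obtain ⟨K, q, hq, hZq⟩ := hZ
  obtain ⟨K', q', hq', hWq⟩ := hW
  exact ⟨_, fun x => Max.max (q x) (q' x), hq.max hq', fun ω => by simp only [hZq, hWq]⟩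

theorem LipOf.comp {n : ℕ} {Z : Ω → ℝ} (hZ : LipOf X n Z) {K : ℝ≥0} {ψ : ℝ → ℝ}
    (hψ : LipschitzWith K ψ) : LipOf X n fun ω => ψ (Z ω) := by
  obtain ⟨K', q, hq, hZq⟩ := hZ
  exact ⟨_, fun x => ψ (q x), hψ.comp hq, fun ω => by simp only [hZq]⟩

theorem LipOf.partialSum {n k : ℕ} (h : k ≤ n) : LipOf X n (partialSum X k) := by
  induction k with
  | zero =>
    refine ⟨0, fun _ => 0, LipschitzWith.const 0, fun ω => ?_⟩
    simp [_root_.partialSum]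
  | succ k ih =>
    obtain ⟨K, q, hq, hS⟩ := (ih (by omega)).add (LipOf.var (X := X) (show k < n by omega))
    refine ⟨K, q, hq, fun ω => ?_⟩
    rw [← hS]
    simp [_root_.partialSum, Finset.sum_range_succ]

/-- The block sum `X m + ⋯ + X (n - 1)`, for `m ≤ n`. -/
def inc (X : ℕ → Ω → ℝ) (m n : ℕ) (ω : Ω) : ℝ := partialSum X n ω - partialSum X m ω

theorem inc_self (X : ℕ → Ω → ℝ) (n : ℕ) : inc X n n = fun _ => 0 := by
  funext ω
  simp [inc]

theorem inc_zero (X : ℕ → Ω → ℝ) (n : ℕ) : inc X 0 n = partialSum X n := by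
  funext ω
  simp [inc, partialSum]

theorem inc_succ (X : ℕ → Ω → ℝ) (m n : ℕ) (ω : Ω) : inc X m (n + 1) ω = inc X m n ω + X n ω := by
  simp only [inc, partialSum, Finset.sum_range_succ]
  ring

theorem inc_one (X : ℕ → Ω → ℝ) (n : ℕ) : inc X n (n + 1) = X n := by
  funext ω
  rw [inc_succ, inc_self, zero_add]

theorem LipOf.inc {a m n : ℕ} (ha : a ≤ n) (hm : m ≤ n) : LipOf X n (inc X a m) :=
  (LipOf.partialSum hm).sub (LipOf.partialSum ha)

/-- The running maximum of a cut-off of the block sums. -/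
noncomputable def runMax (X : ℕ → Ω → ℝ) (L : ℝ) (a : ℕ) : ℕ → Ω → ℝ
  | 0 => fun _ => 0
  | k + 1 => fun ω => max (runMax X L a k ω) (cutoff L (inc X a (a + k + 1) ω))

theorem runMax_mem (L : ℝ) (a k : ℕ) (ω : Ω) : 0 ≤ runMax X L a k ω ∧ runMax X L a k ω ≤ 1 := by
  induction k with
  | zero => exact ⟨le_rfl, zero_le_one⟩
  | succ k ih => exact ⟨ih.1.trans (le_max_left _ _), max_le ih.2 (cutoff_mem _ _).2⟩

theorem lipOf_runMax {L : ℝ} (hL : 0 < L) (a k : ℕ) {n : ℕ} (h : a + k ≤ n) :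
    LipOf X n (runMax X L a k) := by
  induction k with
  | zero => exact LipOf.const n 0
  | succ k ih =>
    exact (ih (by omega)).max ((LipOf.inc (by omega) (by omega)).comp (lipschitzWith_cutoff hL))

theorem cutoff_le_runMax (L : ℝ) (a : ℕ) {i k : ℕ} (hik : i < k) (ω : Ω) :
    cutoff L (inc X a (a + i + 1) ω) ≤ runMax X L a k ω := by
  induction k with
  | zero => omega
  | succ k ih =>
    rcases (Nat.lt_succ_iff.1 hik).eq_or_lt with rfl | hlt
    · exact le_max_right _ _
    · exact (ih hlt).trans (le_max_left _ _)

end Lipschitz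

variable {Ω : Type u} [MeasurableSpace Ω] {P : SublinearSpace Ω} {X : ℕ → Ω → ℝ}

/-! ### Sums of independent random variables -/

/-- The next variable is independent to a weight and a sum formed from the previous ones. -/
theorem IndepSeq.ex_mul (hind : P.IndepSeq X) {n : ℕ} {Q Z : Ω → ℝ} (hQ : LipOf X n Q)
    (hQ01 : ∀ ω, 0 ≤ Q ω ∧ Q ω ≤ 1) (hZ : LipOf X n Z) {K : ℝ≥0} {ψ : ℝ → ℝ}
    (hK : LipschitzWith K ψ) (hψ : Bdd ψ) :
    P.ex (fun ω => Q ω * ψ (Z ω + X n ω)) = P.ex (fun ω => Q ω * P.trans (X n) ψ (Z ω)) := by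
  have hin : ∀ ω, P.ex (fun ω' => Q ω * ψ (Z ω + X n ω')) = Q ω * P.trans (X n) ψ (Z ω) :=
    fun ω => ex_const_mul (hψ.comp _) (hQ01 ω).1
  simp only [← hin]
  cases n with
  -- Independence says nothing about `X 0`, but here Q and Z are constants.
  | zero =>
    obtain ⟨_, q, _, hq⟩ := hQ
    obtain ⟨_, z, _, hz⟩ := hZ
    have hX : ∀ ω, (fun i : Fin 0 => X i ω) = Fin.elim0 := fun ω => Subsingleton.elim _ _
    simp only [hq, hz, hX]
    rw [ex_const]
  | succ n =>
    obtain ⟨K₁, q, hqL, hq⟩ := (hQ.comp (LipschitzWith.id.const_min 1)).comp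
      (LipschitzWith.id.const_max 0)
    obtain ⟨K₂, z, hzL, hz⟩ := hZ
    obtain ⟨C, hC⟩ := hψ
    have hC0 : 0 ≤ C := (abs_nonneg _).trans (hC 0)
    have hq' : ∀ ω, Q ω = Max.max 0 (Min.min 1 (q fun i => X i ω)) := fun ω => by
      rw [← hq]
      simp [(hQ01 ω).1, (hQ01 ω).2]
    -- The truncation bounds the weight on all of ℝⁿ⁺¹, not just on the range of X, making the test
    -- function bounded and Lipschitz.
    let q' : (Fin (n + 1) → ℝ) → ℝ := fun x => Max.max 0 (Min.min 1 (q x))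
    have hq'L : LipschitzWith K₁ q' := (hqL.const_min 1).const_max 0
    have hq'01 : ∀ x, |q' x| ≤ 1 := fun x => by
      rw [abs_of_nonneg (le_max_left _ _)]
      exact max_le zero_le_one (min_le_left _ _)
    have hψL : LipschitzWith (K * (K₂ * 1 + 1 * 1))
        fun y : (Fin (n + 1) → ℝ) × (Fin 1 → ℝ) => ψ (z y.1 + y.2 0) :=
      hK.comp ((hzL.comp LipschitzWith.prod_fst).add
        ((LipschitzWith.eval 0).comp LipschitzWith.prod_snd))
    have key := hind n (fun y => q' y.1 * ψ (z y.1 + y.2 0))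
      ⟨Real.toNNReal (K₁ * C + (K * (K₂ * 1 + 1 * 1) : ℝ≥0)), LipschitzWith.of_dist_le_mul
        fun y y' => ?_⟩ ⟨1 * C, fun y => ?_⟩
    · rw [ex, ex]
      simp only [hq', hz]
      exact congrArg EReal.toReal key
    · have h1 := (hq'L.comp LipschitzWith.prod_fst).dist_le_mul y y'
      have h2 := hψL.dist_le_mul y y'
      rw [Real.coe_toNNReal _ (by positivity), Real.dist_eq]
      simp only [Real.dist_eq, mul_one, Function.comp_apply] at h1 h2
      have h3 : q' y.1 * ψ (z y.1 + y.2 0) - q' y'.1 * ψ (z y'.1 + y'.2 0) =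
          (q' y.1 - q' y'.1) * ψ (z y.1 + y.2 0) +
            q' y'.1 * (ψ (z y.1 + y.2 0) - ψ (z y'.1 + y'.2 0)) := by ring
      rw [h3, add_mul]
      refine (abs_add_le _ _).trans (add_le_add ?_ ?_)
      · rw [abs_mul, mul_right_comm]
        exact mul_le_mul h1 (hC _) (abs_nonneg _) (by positivity)
      · rw [abs_mul]
        refine (mul_le_of_le_one_left (abs_nonneg _) (hq'01 _)).trans ?_
        simpa using h2
    · rw [abs_mul]
      exact mul_le_mul (hq'01 _) (hC _) (abs_nonneg _) zero_le_one

theorem trans_zero (ψ : ℝ → ℝ) : P.trans (fun _ => 0) ψ = ψ := by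
  funext x
  rw [trans, ex_const, add_zero]

theorem bdd_trans (Y : Ω → ℝ) {ψ : ℝ → ℝ} (h : Bdd ψ) : Bdd (P.trans Y ψ) := by
  obtain ⟨C, hC⟩ := h
  exact ⟨C, fun x => abs_ex_le fun ω => hC _⟩

theorem IndepSeq.trans_inc_succ (hind : P.IndepSeq X) {a n : ℕ} (h : a ≤ n) {K : ℝ≥0} {ψ : ℝ → ℝ}
    (hK : LipschitzWith K ψ) (hψ : Bdd ψ) :
    P.trans (inc X a (n + 1)) ψ = P.trans (inc X a n) (P.trans (X n) ψ) := by
  funext s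
  have := hind.ex_mul (LipOf.const n 1) (fun _ => ⟨zero_le_one, le_rfl⟩)
    ((LipOf.const n s).add (LipOf.inc h le_rfl)) hK hψ
  simp only [one_mul] at this
  rw [trans, trans, ← this]
  simp only [inc_succ, add_assoc]

/-- A Chapman–Kolmogorov identity, obtained by peeling off the last variable. -/
theorem IndepSeq.trans_inc (hind : P.IndepSeq X) {a m n : ℕ} (ham : a ≤ m) (hmn : m ≤ n) {K : ℝ≥0}
    {ψ : ℝ → ℝ} (hK : LipschitzWith K ψ) (hψ : Bdd ψ) :
    P.trans (inc X a n) ψ = P.trans (inc X a m) (P.trans (inc X m n) ψ) := by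
  induction n, hmn using Nat.le_induction generalizing ψ with
  | base => rw [inc_self, trans_zero]
  | succ n hmn ih =>
    rw [hind.trans_inc_succ (ham.trans hmn) hK hψ, hind.trans_inc_succ hmn hK hψ]
    exact ih (lipschitzWith_trans _ hψ hK) (bdd_trans _ hψ)

theorem IndepSeq.ex_partialSum (hind : P.IndepSeq X) {m n : ℕ} (hmn : m ≤ n) {K : ℝ≥0}
    {ψ : ℝ → ℝ} (hK : LipschitzWith K ψ) (hψ : Bdd ψ) :
    P.ex (fun ω => ψ (partialSum X n ω)) =
      P.ex (fun ω => P.trans (inc X m n) ψ (partialSum X m ω)) := by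
  have := congrFun (hind.trans_inc (Nat.zero_le m) hmn hK hψ) 0
  simpa only [trans, inc_zero, zero_add] using this

/-! ### Convergence in distribution implies the Cauchy property -/

section Distribution

variable {Ω' : Type v} [MeasurableSpace Ω'] {P' : SublinearSpace Ω'} {S' : Ω' → ℝ}

theorem IndepSeq.exists_cap_inc_lt (hind : P.IndepSeq X) (hS' : P'.Tight S')
    (h : ∀ φ : BoundedContinuousFunction ℝ ℝ,
      Tendsto (fun n => P.expect (fun ω => φ (partialSum X n ω))) atTop
        (𝓝 (P'.expect (fun ω => φ (S' ω))))) {s ε δ : ℝ} (hs : s = 1 ∨ s = -1) (hε : 0 < ε)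
    (hδ : 0 < δ) :
    ∃ N : ℕ, ∀ m ≥ N, ∀ n ≥ m, P.cap {ω | ε ≤ s * inc X m n ω} < δ := by
  obtain ⟨L, hL, hcap⟩ := exists_cap_lt_of_tendsto hS' h (show (0 : ℝ) < 1 / 16 by norm_num)
  obtain ⟨k, hk⟩ := exists_nat_ge (8 * (3 * L) / ε)
  rw [div_le_iff₀ hε] at hk
  obtain ⟨l, hl⟩ := exists_pow_lt_of_lt_one (show (0 : ℝ) < 1 / 2 by norm_num)
    (show 1 - δ ^ k < 1 by linarith [pow_pos hδ k])
  -- Up to l k applications of T then cost at most 1/8; with 1/16 for the initial cut-off and 1/16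
  -- for |S_m| > L this gives the bound 1/4.
  have hη : (0 : ℝ) < 1 / (8 * ((l * k : ℕ) + 1)) := by positivity
  obtain ⟨N₁, hN₁⟩ := eventually_abs_ex_sub_le hS' h (Real.toNNReal L⁻¹) hη
  obtain ⟨N₂, hN₂⟩ := eventually_atTop.1 hcap
  refine ⟨max N₁ N₂, fun m hm n hmn => ?_⟩
  by_contra! hcon
  set Y := inc X m n
  have hm₁ : N₁ ≤ m := (le_max_left _ _).trans hm
  have hφm := iterate_trans_mem (P := P) Y (cutoff_mem L)
  have hχm := iterate_trans_mem (P := P) Y (cutoff_mem (3 * L))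
  have hφL := lipschitzWith_iterate_trans (P := P) Y (cutoff_mem L) (lipschitzWith_cutoff hL)
  have hiter : ∀ i : ℕ, P.ex (fun ω => (P.trans Y)^[i] (cutoff L) (partialSum X m ω)) ≤
      1 / 16 + i * (1 / (8 * ((l * k : ℕ) + 1))) := by
    intro i
    induction i with
    | zero =>
      have := ex_le_cap (P := P) (A := {ω | L < |partialSum X m ω|})
        ((Bdd.of_mem (cutoff_mem L)).comp (partialSum X m))
        (fun ω hω => (cutoff_eq_zero hL (not_lt.1 hω)).le) fun ω => (cutoff_mem L _).2
      simpa using this.trans (hN₂ m ((le_max_right _ _).trans hm)).le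
    | succ i ih =>
      -- Applying T at S_m amounts to passing to S_n, which is within η of S_m on this class.
      have h1 := hind.ex_partialSum hmn (hφL i) (Bdd.of_mem (hφm i))
      have h2 := (abs_le.1 (hN₁ n (hm₁.trans hmn) m hm₁ _ (hφL i) (hφm i))).2
      simp only [Function.iterate_succ_apply']
      push_cast at h2 ih ⊢
      linarith
  refine false_of_iterate_trans_cutoff_le Y hs (show 0 < 3 * L by linarith) hδ.le hcon hk hl
    fun i hi => ?_
  -- Moves the starting point from S_m to 0: if |S_m| ≤ L and |y| ≥ 3L, then |S_m + y| ≥ 2L.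
  have h1 := ex_le_add (P := P) (f := fun _ => (P.trans Y)^[i] (cutoff (3 * L)) 0)
    (g := fun ω => (P.trans Y)^[i] (cutoff L) (partialSum X m ω))
    (h := Set.indicator {ω | L < |partialSum X m ω|} fun _ => 1) (Bdd.const _)
    ((Bdd.of_mem (hφm i)).comp _) (Bdd.indicator _) fun ω => by
      by_cases hω : ω ∈ {ω | L < |partialSum X m ω|}
      · rw [Set.indicator_of_mem hω]
        linarith [(hχm i 0).2, (hφm i (partialSum X m ω)).1]
      · rw [Set.indicator_of_notMem hω, add_zero]
        have := iterate_trans_shift_le (P := P) Y (cutoff_mem L) (cutoff_mem (3 * L))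
          (x := partialSum X m ω) (fun y => by
            rcases le_total |y| (3 * L) with hy | hy
            · rw [cutoff_eq_zero (by linarith) hy]
              exact (cutoff_mem L _).1
            · rw [cutoff_eq_one hL (x := partialSum X m ω + y)]
              · exact (cutoff_mem (3 * L) y).2
              · have h1 := abs_sub_abs_le_abs_sub y (-partialSum X m ω)
                rw [abs_neg, sub_neg_eq_add, add_comm y] at h1
                have h2 : |partialSum X m ω| ≤ L := not_lt.1 hω
                linarith) i 0
        rwa [add_zero] at this
  rw [ex_const] at h1
  have h2 : P.cap {ω | L < |partialSum X m ω|} < 1 / 16 := hN₂ m ((le_max_right _ _).trans hm)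
  have h3 : (i : ℝ) * (1 / (8 * ((l * k : ℕ) + 1))) ≤ 1 / 8 := by
    have : (i : ℝ) ≤ (l * k : ℕ) := by exact_mod_cast hi
    rw [mul_one_div, div_le_iff₀ (by positivity)]
    linarith
  have h4 := hiter i
  unfold cap at h2
  linarith

theorem IndepSeq.cauchyInCapacity (hind : P.IndepSeq X) (hS' : P'.Tight S')
    (h : ∀ φ : BoundedContinuousFunction ℝ ℝ,
      Tendsto (fun n => P.expect (fun ω => φ (partialSum X n ω))) atTop
        (𝓝 (P'.expect (fun ω => φ (S' ω))))) : P.CauchyInCapacity (partialSum X) := by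
  intro ε hε
  rw [tendsto_capacity_zero_iff]
  intro τ hτ
  obtain ⟨N₁, hN₁⟩ := hind.exists_cap_inc_lt hS' h (Or.inl rfl) hε (half_pos hτ)
  obtain ⟨N₂, hN₂⟩ := hind.exists_cap_inc_lt hS' h (Or.inr rfl) hε (half_pos hτ)
  have key : ∀ m ≥ max N₁ N₂, ∀ n ≥ m,
      P.cap {ω | ε ≤ |partialSum X n ω - partialSum X m ω|} < τ := by
    intro m hm n hmn
    have h1 := hN₁ m ((le_max_left _ _).trans hm) n hmn
    have h2 := hN₂ m ((le_max_right _ _).trans hm) n hmn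
    have h3 : {ω | ε ≤ |partialSum X n ω - partialSum X m ω|} ⊆
        {ω | ε ≤ 1 * inc X m n ω} ∪ {ω | ε ≤ -1 * inc X m n ω} := fun ω hω => by
      simpa [inc, le_abs] using hω
    linarith [(cap_mono h3).trans (cap_union_le (P := P) _ _)]
  filter_upwards [eventually_ge_atTop (max N₁ N₂, max N₁ N₂)] with ⟨m, n⟩ hmn
  obtain ⟨hm, hn⟩ := Prod.mk_le_mk.1 hmn
  rcases le_total m n with hle | hle
  · simpa only [abs_sub_comm] using key m hm n hle
  · exact key n hn m hle

end Distribution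

/-! ### A maximal inequality -/

/-- Ottaviani's argument without a stopping time: a Lipschitz running maximum Q replaces the
indicator of a past exceedance. The signed function f = 1/2 - cutoff keeps the estimate inside one
expectation, since 𝔼 is not additive. -/
theorem IndepSeq.cap_exists_le (hind : P.IndepSeq X) {a n : ℕ} (han : a ≤ n) {ε : ℝ} (hε : 0 < ε)
    (h : ∀ j, a ≤ j → j ≤ n → P.cap {ω | ε ≤ |inc X j n ω|} ≤ 1 / 2) :
    P.cap {ω | ∃ i, a ≤ i ∧ i ≤ n ∧ 4 * ε ≤ |inc X a i ω|} ≤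
      2 * P.cap {ω | ε / 2 < |inc X a n ω|} := by
  have hL : 0 < 2 * ε := by linarith
  set f : ℝ → ℝ := fun x => 1 / 2 - cutoff (ε / 2) x with hf
  have hfL : LipschitzWith (0 + Real.toNNReal (ε / 2)⁻¹) f :=
    (LipschitzWith.const _).sub (lipschitzWith_cutoff (half_pos hε))
  have hfB : Bdd f := (Bdd.const _).sub (Bdd.of_mem (cutoff_mem _))
  -- From |x| ≥ 2ε, a remainder below ε ends outside (-ε, ε), where f = -1/2; the other event has
  -- capacity at most 1/2 and adds at most 1 to f.
  have hneg : ∀ j, a ≤ j → j ≤ n → ∀ x, 2 * ε ≤ |x| → P.trans (inc X j n) f x ≤ 0 := by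
    intro j haj hjn x hx
    have h1 := ex_mono (P := P) (hfB.comp fun ω => x + inc X j n ω)
      (g := fun ω => -1 / 2 + 1 * Set.indicator {ω | ε ≤ |inc X j n ω|} (fun _ => 1) ω)
      ((Bdd.const _).add ((Bdd.const _).mul (Bdd.indicator _))) fun ω => by
        by_cases hω : ω ∈ {ω | ε ≤ |inc X j n ω|}
        · rw [Set.indicator_of_mem hω]
          simp only [hf]
          linarith [(cutoff_mem (ε / 2) (x + inc X j n ω)).1]
        · rw [Set.indicator_of_notMem hω]
          have h1 := abs_sub_abs_le_abs_sub x (-inc X j n ω)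
          rw [abs_neg, sub_neg_eq_add] at h1
          have h2 : |inc X j n ω| < ε := not_le.1 hω
          simp only [hf]
          rw [cutoff_eq_one (half_pos hε) (by linarith)]
          norm_num
    rw [ex_add_mul_indicator _ zero_le_one] at h1
    have := h j haj hjn
    rw [trans]
    linarith
  have key : ∀ k, a + k ≤ n →
      P.ex (fun ω => runMax X (2 * ε) a k ω *
        P.trans (inc X (a + k) n) f (inc X a (a + k) ω)) ≤ 0 := by
    intro k
    induction k with
    | zero => intro _; simp [runMax, ex_const]
    | succ k ih =>
      intro hk
      have hC := lipschitzWith_trans (P := P) (inc X (a + k + 1) n) hfB hfL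
      have hCB := bdd_trans (P := P) (inc X (a + k + 1) n) hfB
      have hQ := fun k => Bdd.of_mem (runMax_mem (X := X) (2 * ε) a k)
      have h1 := hind.ex_mul (lipOf_runMax (X := X) hL a k le_rfl) (runMax_mem _ a k)
        (LipOf.inc (Nat.le_add_right a k) le_rfl) hC hCB
      have h2 := hind.trans_inc (Nat.le_succ (a + k)) hk hfL hfB
      rw [inc_one] at h2
      rw [← h2] at h1
      refine le_trans (ex_mono ((hQ _).mul (hCB.comp _))
        ((hQ _).mul (hCB.comp fun ω => inc X a (a + k) ω + X (a + k) ω)) fun ω => ?_)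
        (h1.le.trans (ih (by omega)))
      rw [← inc_succ]
      -- Q grows only where the block sum exceeds 2ε, and there the factor it multiplies is
      -- nonpositive.
      rcases le_total |inc X a (a + k + 1) ω| (2 * ε) with hx | hx
      · have : runMax X (2 * ε) a (k + 1) ω = runMax X (2 * ε) a k ω := by
          change max _ _ = _
          rw [cutoff_eq_zero hL hx, max_eq_left (runMax_mem _ _ _ _).1]
        rw [this]
        rfl
      · exact mul_le_mul_of_nonpos_right (le_max_left _ _) (hneg _ (by omega) hk _ hx)
  have h1 := key (n - a) (by omega)
  rw [Nat.add_sub_cancel' han, inc_self, trans_zero] at h1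
  have hQm := runMax_mem (X := X) (2 * ε) a (n - a)
  have hQ := Bdd.of_mem hQm
  have hc := (Bdd.of_mem (cutoff_mem (ε / 2))).comp (inc X a n)
  -- Pointwise Q / 2 = Q f + Q cutoff ≤ Q f + cutoff, as Q ≤ 1.
  have h2 := ex_le_add (P := P) ((Bdd.const (1 / 2)).mul hQ)
    (hQ.mul (hfB.comp (inc X a n))) hc fun ω => by
      simp only [hf]
      have := mul_le_of_le_one_left (cutoff_mem (ε / 2) (inc X a n ω)).1 (hQm ω).2
      linarith
  rw [ex_const_mul hQ (by norm_num)] at h2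
  have h3 := ex_le_cap (P := P) (A := {ω | ε / 2 < |inc X a n ω|}) hc
    (fun ω hω => (cutoff_eq_zero (half_pos hε) (not_lt.1 hω)).le) fun ω => (cutoff_mem _ _).2
  have h4 := cap_le_ex (P := P) (A := {ω | ∃ i, a ≤ i ∧ i ≤ n ∧ 4 * ε ≤ |inc X a i ω|}) hQ
    (fun ω => (hQm ω).1) fun ω hω => by
      obtain ⟨i, hai, hin, hi⟩ := hω
      rcases hai.eq_or_lt with rfl | hlt
      · rw [inc_self, abs_zero] at hi
        linarith
      · have := cutoff_le_runMax (X := X) (2 * ε) a (i := i - a - 1) (k := n - a) (by omega) ω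
        rwa [show a + (i - a - 1) + 1 = i by omega, cutoff_eq_one hL (by linarith)] at this
  linarith

end SublinearSpace

/-! ### Real sequences with geometrically small oscillation on blocks -/

theorem abs_sub_le_of_forall_block {x : ℕ → ℝ} {N : ℕ → ℕ} (hN : StrictMono N) {K : ℕ}
    (h : ∀ k ≥ K, ∀ i, N k ≤ i → i ≤ N (k + 1) → |x i - x (N k)| ≤ (1 / 2) ^ k) {k : ℕ}
    (hk : K ≤ k) {i : ℕ} (hi : N k ≤ i) : |x i - x (N k)| ≤ 2 * (1 / 2) ^ k := by
  have key : ∀ d i, N k ≤ i → i ≤ N (k + d) →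
      |x i - x (N k)| ≤ 2 * ((1 / 2) ^ k - (1 / 2) ^ (k + d)) := by
    intro d
    induction d with
    | zero =>
      intro i h1 h2
      rw [show i = N k from le_antisymm h2 h1]
      simp
    | succ d ih =>
      intro i h1 h2
      have hp : (1 / 2 : ℝ) ^ (k + (d + 1)) = (1 / 2) ^ (k + d) / 2 := by
        rw [← add_assoc, pow_succ]
        ring
      have hp0 : (0 : ℝ) < (1 / 2) ^ (k + d) := by positivity
      rcases le_total i (N (k + d)) with hi | hi
      · linarith [ih i h1 hi]
      · have h3 := ih (N (k + d)) (hN.monotone (Nat.le_add_right _ _)) le_rfl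
        have h4 := h (k + d) (by omega) i hi h2
        have h5 := abs_sub_le (x i) (x (N (k + d))) (x (N k))
        linarith
  -- Strict monotonicity gives i ≤ N i ≤ N (k + i), so d = i blocks suffice.
  have h1 := key i i hi ((hN.le_apply).trans (hN.monotone (Nat.le_add_left i k)))
  have : (0 : ℝ) < (1 / 2) ^ (k + i) := by positivity
  linarith

theorem exists_tendsto_of_forall_block {x : ℕ → ℝ} {N : ℕ → ℕ} (hN : StrictMono N) {K : ℕ}
    (h : ∀ k ≥ K, ∀ i, N k ≤ i → i ≤ N (k + 1) → |x i - x (N k)| ≤ (1 / 2) ^ k) :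
    ∃ l, Tendsto x atTop (𝓝 l) := by
  refine cauchySeq_tendsto_of_complete (Metric.cauchySeq_iff'.2 fun ε hε => ?_)
  obtain ⟨k, hk⟩ := exists_pow_lt_of_lt_one (half_pos hε) (show (1 / 2 : ℝ) < 1 by norm_num)
  refine ⟨N (max K k), fun i hi => ?_⟩
  have h1 := abs_sub_le_of_forall_block hN h (le_max_left K k) hi
  have h2 : (1 / 2 : ℝ) ^ max K k ≤ (1 / 2) ^ k :=
    pow_le_pow_of_le_one (by norm_num) (by norm_num) (le_max_right K k)
  rw [Real.dist_eq]
  linarith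

/-! ### The almost sure limit and its tightness -/

namespace SublinearSpace

variable {Ω : Type u} [MeasurableSpace Ω] {P : SublinearSpace Ω} {X : ℕ → Ω → ℝ}

theorem CauchyInCapacity.eventually {Z : ℕ → Ω → ℝ} (hZ : P.CauchyInCapacity Z) {ε τ : ℝ}
    (hε : 0 < ε) (hτ : 0 < τ) :
    ∃ N, ∀ m ≥ N, ∀ n ≥ N, P.cap {ω | ε ≤ |Z n ω - Z m ω|} < τ := by
  obtain ⟨⟨N₁, N₂⟩, hN⟩ := eventually_atTop.1 (tendsto_capacity_zero_iff.1 (hZ ε hε) τ hτ)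
  exact ⟨max N₁ N₂, fun m hm n hn => hN (n, m)
    ⟨(le_max_left _ _).trans hn, (le_max_right _ _).trans hm⟩⟩

theorem IndepSeq.eventually_cap_exists_le (hind : P.IndepSeq X)
    (hC : P.CauchyInCapacity (partialSum X)) {ε τ : ℝ} (hε : 0 < ε) (hτ : 0 < τ) :
    ∀ᶠ a in atTop, ∀ n ≥ a, P.cap {ω | ∃ i, a ≤ i ∧ i ≤ n ∧ ε ≤ |inc X a i ω|} ≤ τ := by
  obtain ⟨N₁, hN₁⟩ := hC.eventually (show 0 < ε / 4 by linarith) (show (0 : ℝ) < 1 / 2 by norm_num)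
  obtain ⟨N₂, hN₂⟩ := hC.eventually (show 0 < ε / 4 / 2 by linarith) (half_pos hτ)
  filter_upwards [eventually_ge_atTop (max N₁ N₂)] with a ha n hn
  have ha₁ := (le_max_left _ _).trans ha
  have ha₂ := (le_max_right _ _).trans ha
  have h1 := hind.cap_exists_le hn (show 0 < ε / 4 by linarith) fun j haj hjn =>
    (hN₁ j (ha₁.trans haj) n (ha₁.trans hn)).le
  rw [mul_div_cancel₀ ε (by norm_num)] at h1
  have h2 : P.cap {ω | ε / 4 / 2 < |inc X a n ω|} ≤
      P.cap {ω | ε / 4 / 2 ≤ |partialSum X n ω - partialSum X a ω|} :=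
    cap_mono fun ω hω => (show ε / 4 / 2 < |inc X a n ω| from hω).le
  linarith [hN₂ a ha₂ n (ha₂.trans hn)]

theorem CountablySubadditive.cap_iUnion_le (hP : P.CountablySubadditive) {A : ℕ → Set Ω}
    (hA : ∀ k, MeasurableSet (A k)) {K : ℕ} (h : ∀ k, P.cap (A k) ≤ (1 / 2) ^ (K + k)) :
    P.cap (⋃ k, A k) ≤ 2 * (1 / 2) ^ K := by
  have h1 : P.capacity (⋃ k, A k) ≤ ∑' k, ENNReal.ofReal ((1 / 2) ^ K * (1 / 2) ^ k) := by
    refine (hP A hA).trans (ENNReal.tsum_le_tsum fun k => ?_)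
    rw [capacity_eq, ← pow_add]
    exact ENNReal.ofReal_le_ofReal (h k)
  rw [← ENNReal.ofReal_tsum_of_nonneg (fun k => by positivity)
    (summable_geometric_two.mul_left _), tsum_mul_left, tsum_geometric_two, capacity_eq,
    ENNReal.ofReal_le_ofReal_iff (by positivity)] at h1
  linarith

/-- Borel–Cantelli: choose N k so that oscillation 2⁻ᵏ within the k-th block has capacity at most
2⁻ᵏ. Off the union of the bad events from K on, of capacity at most 2 · 2⁻ᴷ, the sums converge at an
explicit rate, giving both modes of convergence. -/
theorem IndepSeq.exists_tendstoAlmostSurely (hX : ∀ n, Measurable (X n)) (hind : P.IndepSeq X)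
    (hC : P.CauchyInCapacity (partialSum X)) (hP : P.CountablySubadditive) :
    ∃ S : Ω → ℝ, Measurable S ∧ P.TendstoInCapacity (partialSum X) S ∧
      P.TendstoAlmostSurely (partialSum X) S := by
  classical
  have hSm : ∀ n, Measurable (partialSum X n) := fun n =>
    Finset.measurable_sum _ fun i _ => hX i
  obtain ⟨N, hNm, hN⟩ := extraction_forall_of_eventually fun k : ℕ =>
    hind.eventually_cap_exists_le hC (show (0 : ℝ) < (1 / 2) ^ k by positivity)
      (show (0 : ℝ) < (1 / 2) ^ k by positivity)
  let A : ℕ → Set Ω := fun k =>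
    {ω | ∃ i, N k ≤ i ∧ i ≤ N (k + 1) ∧ (1 / 2) ^ k ≤ |inc X (N k) i ω|}
  have hA : ∀ k, MeasurableSet (A k) := by
    intro k
    have : A k = ⋃ i, ⋃ (_ : N k ≤ i), ⋃ (_ : i ≤ N (k + 1)),
        {ω | (1 / 2) ^ k ≤ |inc X (N k) i ω|} := by
      ext ω
      simp only [A, Set.mem_iUnion, Set.mem_ofPred_eq, exists_prop]
    rw [this]
    refine MeasurableSet.iUnion fun i => MeasurableSet.iUnion fun _ => MeasurableSet.iUnion fun _ =>
      measurableSet_le measurable_const ?_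
    exact measurable_abs.comp ((hSm i).sub (hSm (N k)))
  have hB : ∀ K, P.cap (⋃ k, A (K + k)) ≤ 2 * (1 / 2) ^ K := fun K =>
    hP.cap_iUnion_le (fun k => hA _) fun k => hN _ _ (hNm.monotone (Nat.le_succ _))
  have hsmall : ∀ τ : ℝ, 0 < τ → ∃ K₀, ∀ K ≥ K₀, 4 * (1 / 2 : ℝ) ^ K < τ := by
    intro τ hτ
    obtain ⟨K₀, hK₀⟩ := exists_pow_lt_of_lt_one (show 0 < τ / 4 by linarith)
      (show (1 / 2 : ℝ) < 1 by norm_num)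
    refine ⟨K₀, fun K hK => ?_⟩
    have : (1 / 2 : ℝ) ^ K ≤ (1 / 2) ^ K₀ := pow_le_pow_of_le_one (by norm_num) (by norm_num) hK
    linarith
  have hblock : ∀ K, ∀ ω ∉ ⋃ k, A (K + k), ∀ k ≥ K, ∀ i, N k ≤ i → i ≤ N (k + 1) →
      |partialSum X i ω - partialSum X (N k) ω| ≤ (1 / 2) ^ k := by
    intro K ω hω k hk i h1 h2
    by_contra! h3
    exact hω (Set.mem_iUnion.2 ⟨k - K, i, by rwa [Nat.add_sub_cancel' hk],
      by rwa [Nat.add_sub_cancel' hk], by rw [Nat.add_sub_cancel' hk]; exact h3.le⟩)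
  let E : Set Ω := {ω | ∃ l, Tendsto (fun n => partialSum X n ω) atTop (𝓝 l)}
  have hE : MeasurableSet E := MeasureTheory.measurableSet_exists_tendsto hSm
  -- The value 0 off E makes S the pointwise limit of the measurable functions `E.indicator
  -- (partialSum X n)`.
  let S : Ω → ℝ := fun ω => if h : ω ∈ E then h.choose else 0
  have hSE : ∀ ω ∈ E, Tendsto (fun n => partialSum X n ω) atTop (𝓝 (S ω)) := by
    intro ω hω
    simp only [S, dif_pos hω]
    exact hω.choose_spec
  have hBE : ∀ K, ∀ ω ∉ ⋃ k, A (K + k), ω ∈ E := fun K ω hω =>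
    exists_tendsto_of_forall_block hNm (hblock K ω hω)
  refine ⟨S, ?_, ?_, ?_⟩
  · refine measurable_of_tendsto_metrizable (f := fun n => E.indicator (partialSum X n))
      (fun n => (hSm n).indicator hE) (tendsto_pi_nhds.2 fun ω => ?_)
    by_cases hω : ω ∈ E
    · simpa only [Set.indicator_of_mem hω] using hSE ω hω
    · simp only [Set.indicator_of_notMem hω, S, dif_neg hω]
      exact tendsto_const_nhds
  · intro ε hε
    rw [tendsto_capacity_zero_iff]
    intro τ hτ
    obtain ⟨K₁, hK₁⟩ := hsmall ε hε
    obtain ⟨K₂, hK₂⟩ := hsmall τ hτ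
    set K := max K₁ K₂
    filter_upwards [eventually_ge_atTop (N K)] with n hn
    have hsub : {ω | ε ≤ |partialSum X n ω - S ω|} ⊆ ⋃ k, A (K + k) := by
      intro ω hω
      by_contra hωB
      have h1 := fun i (hi : N K ≤ i) =>
        abs_sub_le_of_forall_block hNm (hblock K ω hωB) le_rfl hi
      have h2 : |S ω - partialSum X (N K) ω| ≤ 2 * (1 / 2) ^ K :=
        le_of_tendsto (((hSE ω (hBE K ω hωB)).sub_const _).abs)
          (eventually_atTop.2 ⟨N K, h1⟩)
      have h3 := abs_sub_le (partialSum X n ω) (partialSum X (N K) ω) (S ω)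
      rw [abs_sub_comm (partialSum X (N K) ω)] at h3
      have h4 : ε ≤ |partialSum X n ω - S ω| := hω
      linarith [h1 n hn, hK₁ K (le_max_left _ _)]
    have : (0 : ℝ) < (1 / 2) ^ K := by positivity
    linarith [cap_mono (P := P) hsub, hB K, hK₂ K (le_max_right _ _)]
  · rw [TendstoAlmostSurely, capacity_eq, ENNReal.ofReal_eq_zero]
    refine le_of_forall_pos_le_add fun τ hτ => ?_
    obtain ⟨K, hK⟩ := hsmall τ hτ
    have hsub : {ω | ¬ Tendsto (fun n => partialSum X n ω) atTop (𝓝 (S ω))} ⊆ ⋃ k, A (K + k) := by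
      intro ω hω
      by_contra hωB
      exact hω (hSE ω (hBE K ω hωB))
    have : (0 : ℝ) < (1 / 2) ^ K := by positivity
    linarith [cap_mono (P := P) hsub, hB K, hK K le_rfl]

/-- A single n suffices: Z n is mostly within L of 0 and S mostly within 1 of Z n. -/
theorem tight_of_tendstoInCapacity {Z : ℕ → Ω → ℝ} {S : Ω → ℝ} (hZ : P.TendstoInCapacity Z S)
    (h : ∀ τ : ℝ, 0 < τ → ∃ L : ℝ, 0 < L ∧ ∀ᶠ n in atTop, P.cap {ω | L < |Z n ω|} < τ) :
    P.Tight S := by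
  rw [Tight, tendsto_capacity_zero_iff]
  intro τ hτ
  obtain ⟨L, -, hL⟩ := h (τ / 2) (half_pos hτ)
  obtain ⟨n, hn, hn'⟩ :=
    (hL.and (tendsto_capacity_zero_iff.1 (hZ 1 one_pos) (τ / 2) (half_pos hτ))).exists
  filter_upwards [eventually_ge_atTop (L + 1)] with x hx
  have hsub : {ω | x < |S ω|} ⊆ {ω | L < |Z n ω|} ∪ {ω | 1 ≤ |Z n ω - S ω|} := by
    intro ω hω
    by_contra hcon
    simp only [Set.mem_union, Set.mem_ofPred_eq, not_or, not_lt, not_le] at hcon hω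
    have := abs_sub_abs_le_abs_sub (S ω) (Z n ω)
    rw [abs_sub_comm] at this
    linarith [hcon.1, hcon.2]
  linarith [cap_mono (P := P) hsub, cap_union_le (P := P) {ω | L < |Z n ω|}
    {ω | 1 ≤ |Z n ω - S ω|}]

end SublinearSpace

theorem mainTheorem3 {Ω : Type u} [MeasurableSpace Ω] (P : SublinearSpace Ω)
    (X : ℕ → Ω → ℝ) (hX : ∀ n, X n ∈ P.H) (hind : P.IndepSeq X) :
    (∀ S : Ω → ℝ, Measurable S → P.TendstoInCapacity (partialSum X) S → P.Tight S →
      ∀ φ : BoundedContinuousFunction ℝ ℝ,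
        Tendsto (fun n => P.expect (fun ω => φ (partialSum X n ω))) atTop
          (𝓝 (P.expect (fun ω => φ (S ω))))) ∧
    (∀ {Ω' : Type v} [MeasurableSpace Ω'] (P' : SublinearSpace Ω') (S' : Ω' → ℝ),
      Measurable S' → P'.Tight S' →
      (∀ φ : BoundedContinuousFunction ℝ ℝ,
        Tendsto (fun n => P.expect (fun ω => φ (partialSum X n ω))) atTop
          (𝓝 (P'.expect (fun ω => φ (S' ω))))) →
      P.CauchyInCapacity (partialSum X) ∧
      (P.CountablySubadditive →
        ∃ S : Ω → ℝ, Measurable S ∧ P.Tight S ∧ P.TendstoInCapacity (partialSum X) S ∧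
          P.TendstoAlmostSurely (partialSum X) S)) := by
  refine ⟨fun S _ hS hT φ => hS.tendsto_expect hT φ, ?_⟩
  intro Ω' _ P' S' _ hS' h
  have hC := hind.cauchyInCapacity hS' h
  refine ⟨hC, fun hP => ?_⟩
  obtain ⟨S, hSm, hS, hSa⟩ := hind.exists_tendstoAlmostSurely
    (fun n => P.measurable_of_mem _ (hX n)) hC hP
  exact ⟨S, hSm, SublinearSpace.tight_of_tendstoInCapacity hS fun τ hτ =>
    SublinearSpace.exists_cap_lt_of_tendsto hS' h hτ, hS, hSa⟩
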